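/- Let $S$ be a topological distributive lattice, that is, a distributive lattice with join $\oplus$, endowed with a Hausdorff topology for which $(x,y)\mapsto x\oplus y$ is continuous from $S\times S$ to $S$ (continuity of the meet is not needed). Suppose that $S$ has finite breadth $b$, meaning that $b$ is the least integer such that every nonempty finite subset $F$ of $S$ has a nonempty subset $G$ with at most $b$ elements and $\bigoplus G=\bigoplus F$. Call a subset of $S$ convex if it is closed under $\oplus$ (the empty set included), let $\operatorname{co}(A)$ denote the smallest convex subset containing $A$, and call $x\in A$ an extreme point of $A$ if $x\notin\operatorname{co}(A\setminus\{x\})$. Let $K$ be a compact convex subset of $S$. Then for every $x\in K$ there is a nonempty finite set $G$ of extreme points of $K$, with at most $b$ elements, such that $x=\bigoplus G$. -/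

import Mathlib

/-- `b` bounds the breadth of the join-semilattice `S`: every nonempty finite subset `F` has a
(nonempty) subset `G` with at most `b` elements and the same join. -/
def BreadthLE (S : Type*) [SemilatticeSup S] (b : ℕ) : Prop :=
  ∀ (F : Finset S) (hF : F.Nonempty), ∃ (G : Finset S) (hG : G.Nonempty),
    G ⊆ F ∧ G.card ≤ b ∧ F.sup' hF id = G.sup' hG id

/-- `S` has finite breadth, equal to `b`: `b` is the least bound. -/
def HasBreadth (S : Type*) [SemilatticeSup S] (b : ℕ) : Prop :=
  IsLeast {n : ℕ | BreadthLE S n} b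

/-- Extreme points of `A` for the algebraic convexity of a join-semilattice. The convex sets are
the subsemilattices (`SupClosed`, the empty set included), so the convex hull is `supClosure`; an
extreme point of `A` is a point `x` of `A` that is not in the convex hull of `A \ {x}`. -/
def semilatticeExtremePoints {S : Type*} [SemilatticeSup S] (A : Set S) : Set S :=
  {x | x ∈ A ∧ x ∉ supClosure (A \ {x})}

/-! Breadth bounds the length of irredundant decompositions of `x` in `K`, so a longest one exists.
Among decompositions of that length, compactness gives one that is minimal coordinatewise and still
irredundant. Its members are extreme: if one were `u ⊔ v` with `u`, `v` strictly smaller, replacing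
it by the pair would give a longer decomposition, irredundant by minimality, against maximality
(`mem_extremePoints_of_minimal_decomposition`). -/

/-- In a semilattice with continuous join and Hausdorff topology, every element of a compact set
lies above a minimal element of that set. -/
theorem IsCompact.exists_le_minimal {X : Type*} [SemilatticeSup X] [TopologicalSpace X] [T2Space X]
    [ContinuousSup X] {A : Set X} (hA : IsCompact A) {a : X} (ha : a ∈ A) :
    ∃ m, m ≤ a ∧ Minimal (· ∈ A) m := by
  have hclosed : ∀ c : X, IsClosed (Set.Iic c) := fun c => by
    have : Set.Iic c = {y | y ⊔ c = c} := by ext y; simp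
    rw [this]
    exact isClosed_eq (by fun_prop) continuous_const
  refine @zorn_le_nonempty₀ Xᵒᵈ _ A (fun c hcA hc y hy => ?_) a ha
  have : Nonempty c := ⟨⟨y, hy⟩⟩
  -- A point common to these nested compact sets is a lower bound of the chain in `A`.
  have hne : (⋂ i : c, A ∩ Set.Iic (OrderDual.ofDual i.1)).Nonempty := by
    refine IsCompact.nonempty_iInter_of_directed_nonempty_isCompact_isClosed _ ?_ ?_ ?_ ?_
    · intro i j
      rcases hc.total i.2 j.2 with h | h
      · exact ⟨j, fun z hz => ⟨hz.1, le_trans hz.2 h⟩, fun z hz => hz⟩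
      · exact ⟨i, fun z hz => hz, fun z hz => ⟨hz.1, le_trans hz.2 h⟩⟩
    · exact fun i => ⟨OrderDual.ofDual i.1, hcA i.2, le_rfl⟩
    · exact fun i => hA.inter_right (hclosed _)
    · exact fun i => hA.isClosed.inter (hclosed _)
  obtain ⟨z, hz⟩ := hne
  rw [Set.mem_iInter] at hz
  exact ⟨z, (hz ⟨y, hy⟩).1, fun w hw => (hz ⟨w, hw⟩).2⟩

/-- A family in a join-semilattice is join-irredundant if no member lies below a finite join of
other members. -/
def SupIrredundant {ι S : Type*} [SemilatticeSup S] (y : ι → S) : Prop :=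
  ∀ (i : ι) (T : Finset ι) (hT : T.Nonempty), i ∉ T → ¬ y i ≤ T.sup' hT y

theorem SupIrredundant.injective {ι S : Type*} [SemilatticeSup S] {y : ι → S}
    (hy : SupIrredundant y) : Function.Injective y := by
  intro i j hij
  by_contra hne
  exact hy i {j} (Finset.singleton_nonempty j) (by simpa using hne) (by simp [hij])

/-- The size of a join-irredundant family is at most the breadth. -/
theorem SupIrredundant.card_le {ι S : Type*} [Fintype ι] [Nonempty ι] [SemilatticeSup S]
    {y : ι → S} (hy : SupIrredundant y) {b : ℕ} (hb : BreadthLE S b) : Fintype.card ι ≤ b := by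
  classical
  obtain ⟨G, hG, hGF, hGb, hsup⟩ :=
    hb (Finset.univ.image y) (Finset.univ_nonempty.image y)
  suffices h : Finset.univ.image y ⊆ G by
    rw [← Finset.card_univ, ← Finset.card_image_of_injective _ hy.injective]
    exact (Finset.card_le_card h).trans hGb
  intro z hz
  obtain ⟨i, -, rfl⟩ := Finset.mem_image.1 hz
  by_contra hi
  have hGT : ∀ g ∈ G, ∃ j ∈ Finset.univ.filter (fun j => y j ∈ G), y j = g := by
    intro g hg
    obtain ⟨j, -, rfl⟩ := Finset.mem_image.1 (hGF hg)
    exact ⟨j, by simpa using hg, rfl⟩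
  obtain ⟨g, hg⟩ := hG
  obtain ⟨j₀, hj₀, -⟩ := hGT g hg
  refine hy i (Finset.univ.filter fun j => y j ∈ G) ⟨j₀, hj₀⟩ (by simpa using hi) ?_
  have hle : y i ≤ G.sup' ⟨g, hg⟩ id := hsup ▸ Finset.le_sup' id hz
  refine hle.trans (Finset.sup'_le _ _ fun g hg => ?_)
  obtain ⟨j, hj, rfl⟩ := hGT g hg
  exact Finset.le_sup' y hj

/-- Shrinking the members of a join-irredundant family without changing the join preserves
irredundancy. -/
theorem SupIrredundant.mono {ι S : Type*} [Fintype ι] [Nonempty ι] [SemilatticeSup S]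
    {y z : ι → S} (hy : SupIrredundant y) (hzy : z ≤ y)
    (hsup : Finset.univ.sup' Finset.univ_nonempty z = Finset.univ.sup' Finset.univ_nonempty y) :
    SupIrredundant z := by
  classical
  intro i T hT hi hle
  have hsub : T ⊆ Finset.univ.erase i := fun j hj =>
    Finset.mem_erase.2 ⟨fun h => hi (h ▸ hj), Finset.mem_univ j⟩
  refine hy i (Finset.univ.erase i) (hT.mono hsub) (by simp) ?_
  refine (Finset.le_sup' y (Finset.mem_univ i)).trans (hsup ▸ Finset.sup'_le _ _ fun j _ => ?_)
  rcases eq_or_ne j i with rfl | hji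
  · exact hle.trans (Finset.sup'_le _ _ fun l hl => (hzy l).trans (Finset.le_sup' y (hsub hl)))
  · exact (hzy j).trans (Finset.le_sup' y (by simp [hji]))

/-- An element of a subsemilattice that is not a join of two other elements is extreme. -/
theorem mem_semilatticeExtremePoints_of_forall_sup {S : Type*} [SemilatticeSup S] {K : Set S}
    {a : S} (ha : a ∈ K) (hK : SupClosed K)
    (h : ∀ u ∈ K, ∀ v ∈ K, u ⊔ v = a → u = a ∨ v = a) : a ∈ semilatticeExtremePoints K := by
  refine ⟨ha, fun hmem => ?_⟩
  -- Removing `a` leaves a subsemilattice, which is its own hull.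
  have hcl : SupClosed (K \ {a}) := fun u hu v hv =>
    ⟨hK hu.1 hv.1, fun he => (h u hu.1 v hv.1 he).elim hu.2 hv.2⟩
  rw [hcl.supClosure_eq] at hmem
  exact hmem.2 rfl

/-- The irredundant decompositions of `x` in `K` into `k + 1` elements. -/
def irredundantDecompositions {S : Type*} [SemilatticeSup S] (K : Set S) (x : S) (k : ℕ) :
    Set (Fin (k + 1) → S) :=
  {y | (∀ i, y i ∈ K) ∧ Finset.univ.sup' Finset.univ_nonempty y = x ∧ SupIrredundant y}

/-- If an irredundant decomposition of maximal length is also minimal, then its members are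
extreme points. -/
theorem mem_extremePoints_of_minimal_decomposition {S : Type*} [SemilatticeSup S] {K : Set S}
    (hK : SupClosed K) {x : S} {k : ℕ} {y : Fin (k + 1) → S}
    (hy : y ∈ irredundantDecompositions K x k)
    (hmax : irredundantDecompositions K x (k + 1) = ∅)
    (hmin : ∀ z : Fin (k + 1) → S, (∀ i, z i ∈ K) →
      Finset.univ.sup' Finset.univ_nonempty z = x → z ≤ y → z = y)
    (i : Fin (k + 1)) : y i ∈ semilatticeExtremePoints K := by
  obtain ⟨hyK, hyx, hirr⟩ := hy
  refine mem_semilatticeExtremePoints_of_forall_sup (hyK i) hK fun u hu v hv huv => ?_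
  by_contra! hne
  have hux : u ≤ y i := huv ▸ le_sup_left
  have hvx : v ≤ y i := huv ▸ le_sup_right
  have hyle : ∀ j, y j ≤ x := fun j => hyx ▸ Finset.le_sup' y (Finset.mem_univ j)
  -- Otherwise the family with `w` in place of `y i` would still join to `x`, against minimality.
  have key : ∀ w ∈ K, w ≤ y i → w ≠ y i →
      ¬ y i ≤ Finset.univ.sup' Finset.univ_nonempty (Function.update y i w) := by
    intro w hw hwy hwne hle
    have hupd : Function.update y i w ≤ y := update_le_self_iff.2 hwy
    refine hwne ?_
    have := hmin (Function.update y i w) (fun j => ?_) (le_antisymm ?_ ?_) hupd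
    · simpa using congrFun this i
    · rcases eq_or_ne j i with rfl | hji
      · simpa using hw
      · simpa [hji] using hyK j
    · exact Finset.sup'_le _ _ fun j _ => (hupd j).trans (hyle j)
    · rw [← hyx]
      refine Finset.sup'_le _ _ fun j _ => ?_
      rcases eq_or_ne j i with rfl | hji
      · exact hle
      · exact le_of_eq_of_le (by simp [hji]) (Finset.le_sup' _ (Finset.mem_univ j))
  have hz : (Fin.cons u (Function.update y i v) : Fin (k + 2) → S) ∈
      irredundantDecompositions K x (k + 1) := by
    have hupd : Function.update y i v ≤ y := update_le_self_iff.2 hvx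
    have hcons : ∀ c, u ≤ c → v ≤ c → (∀ j, j ≠ i → y j ≤ c) → ∀ j, y j ≤ c := by
      intro c huc hvc h j
      rcases eq_or_ne j i with rfl | hji
      · exact huv ▸ sup_le huc hvc
      · exact h j hji
    refine ⟨fun j => ?_, le_antisymm (Finset.sup'_le _ _ fun j _ => ?_) ?_, ?_⟩
    · refine Fin.cases hu (fun l => ?_) j
      rcases eq_or_ne l i with rfl | hli
      · simpa using hv
      · simpa [hli] using hyK l
    · exact Fin.cases (hux.trans (hyle i)) (fun l => (hupd l).trans (hyle l)) j
    · have hle : ∀ j, (Fin.cons u (Function.update y i v) : Fin (k + 2) → S) j ≤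
          Finset.univ.sup' Finset.univ_nonempty
            (Fin.cons u (Function.update y i v) : Fin (k + 2) → S) :=
        fun j => Finset.le_sup' _ (Finset.mem_univ j)
      rw [← hyx]
      refine Finset.sup'_le _ _ fun j _ => hcons _ (hle 0) ?_ (fun l hl => ?_) j
      · simpa using hle i.succ
      · simpa [hl] using hle l.succ
    · intro j T hT hj hle
      rcases Fin.eq_zero_or_eq_succ j with rfl | ⟨l, rfl⟩
      · -- `u` is absorbed by the others, so `v` could replace `y i`
        have hU : ∀ l, Function.update y i v l ≤
            Finset.univ.sup' Finset.univ_nonempty (Function.update y i v) :=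
          fun l => Finset.le_sup' _ (Finset.mem_univ l)
        refine key v hv hvx hne.2 (huv ▸ sup_le (hle.trans (Finset.sup'_le _ _ fun t ht => ?_)) ?_)
        · rcases Fin.eq_zero_or_eq_succ t with rfl | ⟨s, rfl⟩
          · exact absurd ht hj
          · exact hU s
        · simpa using hU i
      · rcases eq_or_ne l i with rfl | hli
        · -- `v` is absorbed by the others, so `u` could replace `y i`
          have hU : ∀ s, Function.update y l u s ≤
              Finset.univ.sup' Finset.univ_nonempty (Function.update y l u) :=
            fun s => Finset.le_sup' _ (Finset.mem_univ s)
          have hUl := hU l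
          rw [Function.update_self] at hUl
          simp only [Fin.cons_succ, Function.update_self] at hle
          refine key u hu hux hne.1
            (huv ▸ sup_le hUl (hle.trans (Finset.sup'_le _ _ fun t ht => ?_)))
          rcases Fin.eq_zero_or_eq_succ t with rfl | ⟨s, rfl⟩
          · exact hUl
          · have hsl : s ≠ l := fun h => hj (h ▸ ht)
            simpa [hsl] using hU s
        · -- another member is absorbed, against irredundancy
          refine hirr l (Finset.univ.erase l) ⟨i, by simp [hli.symm]⟩ (by simp) ?_
          simp only [Fin.cons_succ, Function.update_of_ne hli] at hle
          refine hle.trans (Finset.sup'_le _ _ fun t ht => ?_)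
          rcases Fin.eq_zero_or_eq_succ t with rfl | ⟨s, rfl⟩
          · exact hux.trans (Finset.le_sup' y (by simp [hli.symm]))
          · have hsl : s ≠ l := fun h => hj (h ▸ ht)
            exact (hupd s).trans (Finset.le_sup' y (by simp [hsl]))
  rw [hmax] at hz
  exact hz

/-- A compact subsemilattice of a Hausdorff semilattice of breadth at most `b`: every element is
the join of at most `b` extreme points. -/
theorem exists_extremePoints_sup_eq {S : Type*} [SemilatticeSup S] [TopologicalSpace S] [T2Space S]
    [ContinuousSup S] {b : ℕ} (hb : BreadthLE S b) {K : Set S} (hKcompact : IsCompact K)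
    (hK : SupClosed K) {x : S} (hx : x ∈ K) :
    ∃ (G : Finset S) (hG : G.Nonempty),
      (G : Set S) ⊆ semilatticeExtremePoints K ∧ G.card ≤ b ∧ x = G.sup' hG id := by
  classical
  have h0 : (irredundantDecompositions K x 0).Nonempty := by
    -- With a single index, no nonempty `T` avoids it.
    refine ⟨fun _ => x, fun _ => hx, by simp, fun i T hT hi => ?_⟩
    obtain ⟨j, hj⟩ := hT
    exact absurd ((Fin.fin_one_eq_zero j).trans (Fin.fin_one_eq_zero i).symm ▸ hj) hi
  have hbound : ∀ k, (irredundantDecompositions K x k).Nonempty → k + 1 ≤ b := by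
    rintro k ⟨y, -, -, hy⟩
    simpa using hy.card_le hb
  obtain ⟨k, ⟨y, hyK, hyx, hyirr⟩, hkmax⟩ : ∃ k, (irredundantDecompositions K x k).Nonempty ∧
      irredundantDecompositions K x (k + 1) = ∅ := by
    by_contra! h
    have hall : ∀ k, (irredundantDecompositions K x k).Nonempty := fun k =>
      Nat.rec h0 (fun k ih => h k ih) k
    -- Decompositions of every length would include one of length `b + 1`.
    have := hbound b (hall b)
    omega
  -- Irredundancy need not be a closed condition, so it is left out here and recovered for the
  -- minimal family from `SupIrredundant.mono`.
  have hcompact : IsCompact ({z : Fin (k + 1) → S | ∀ i, z i ∈ K} ∩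
      {z | Finset.univ.sup' Finset.univ_nonempty z = x}) := by
    refine (isCompact_pi_infinite fun _ => hKcompact).inter_right (isClosed_eq ?_ continuous_const)
    exact Continuous.finset_sup'_apply _ fun i _ => continuous_apply i
  have : ContinuousSup (Fin (k + 1) → S) :=
    ⟨continuous_pi fun i => ((continuous_apply i).comp continuous_fst).sup
      ((continuous_apply i).comp continuous_snd)⟩
  obtain ⟨m, hmy, ⟨hmK, hmx⟩, hmin⟩ := hcompact.exists_le_minimal (a := y) ⟨hyK, hyx⟩
  have hmirr : SupIrredundant m := hyirr.mono hmy (hmx.trans hyx.symm)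
  refine ⟨Finset.univ.image m, Finset.univ_nonempty.image m, ?_, ?_, ?_⟩
  · intro z hz
    obtain ⟨i, -, rfl⟩ := Finset.mem_image.1 (Finset.mem_coe.1 hz)
    exact mem_extremePoints_of_minimal_decomposition hK ⟨hmK, hmx, hmirr⟩ hkmax
      (fun z hzK hzx hzm => le_antisymm hzm (hmin ⟨hzK, hzx⟩ hzm)) i
  · exact Finset.card_image_le.trans (by simpa using hbound k ⟨m, hmK, hmx, hmirr⟩)
  · rw [Finset.sup'_image]
    exact hmx.symm

theorem mainTheorem4 {S : Type*} [DistribLattice S] [TopologicalSpace S] [T2Space S]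
    [ContinuousSup S] (b : ℕ) (hb : HasBreadth S b)
    (K : Set S) (hKcompact : IsCompact K) (hKconvex : SupClosed K)
    (x : S) (hx : x ∈ K) :
    ∃ (G : Finset S) (hG : G.Nonempty),
      (G : Set S) ⊆ semilatticeExtremePoints K ∧ G.card ≤ b ∧ x = G.sup' hG id :=
  exists_extremePoints_sup_eq hb.1 hKcompact hKconvex hx
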